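/- Let $\mathbb D=\{z\in\mathbb C:|z|<1\}$. Let $v:[0,1)\to(0,\infty)$ be continuous and increasing (not necessarily strictly) with $\lim_{r\to1^-}v(r)=\infty$, let $v$ be log-convex, i.e. the function $x\mapsto\log v(e^x)$ is convex on $(-\infty,0)$, and put $w(r)=v(r)/(1-r)$ for $r\in[0,1)$. For $u\in\{v,w\}$ let $H_u(\mathbb D)$ be the space of all holomorphic functions $f$ on $\mathbb D$ with $$\|f\|_u:=\sup_{z\in\mathbb D}\frac{|f(z)|}{u(|z|)}<\infty,$$ endowed with the norm $\|\cdot\|_u$. Then the differentiation operator $D:f\mapsto f'$ is an epimorphism from $H_v(\mathbb D)$ to $H_w(\mathbb D)$ (that is, $D$ maps $H_v(\mathbb D)$ into $H_w(\mathbb D)$, and $D:H_v(\mathbb D)\to H_w(\mathbb D)$ is continuous and surjective) if and only if $$0<\liminf_{r\to1^-}\frac{(1-r)v'(r)}{v(r)}\le\limsup_{r\to1^-}\frac{(1-r)v'(r)}{v(r)}<\infty,$$ where $v'$ denotes the right derivative of $v$, which exists on $(0,1)$ by log-convexity. -/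

import Mathlib

open Set Filter Topology

noncomputable section

/-- A weight on an open set `G ⊆ ℂ`: a positive continuous function on `G`. -/
structure Weight (G : TopologicalSpace.Opens ℂ) where
  toFun : G → ℝ
  pos : ∀ z, 0 < toFun z
  continuous : Continuous toFun

/-- Extension by zero of a function on `G` to all of `ℂ`. -/
def zeroExtend {G : TopologicalSpace.Opens ℂ} (f : G → ℂ) : ℂ → ℂ :=
  Function.extend Subtype.val f 0

/-- `f` is holomorphic on the open set `G`. -/
def IsHolomorphic {G : TopologicalSpace.Opens ℂ} (f : G → ℂ) : Prop :=
  DifferentiableOn ℂ (zeroExtend f) (G : Set ℂ)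

/-- The derivative `f'` of a function `f` on `G`. -/
def complexDeriv {G : TopologicalSpace.Opens ℂ} (f : G → ℂ) : G → ℂ :=
  fun z => deriv (zeroExtend f) (z : ℂ)

theorem zeroExtend_add {G : TopologicalSpace.Opens ℂ} (f g : G → ℂ) :
    zeroExtend (f + g) = zeroExtend f + zeroExtend g := by
  have h := Function.extend_add (Subtype.val : G → ℂ) f g (0 : ℂ → ℂ) 0
  simpa [zeroExtend] using h

theorem zeroExtend_smul {G : TopologicalSpace.Opens ℂ} (c : ℂ) (f : G → ℂ) :
    zeroExtend (c • f) = c • zeroExtend f := by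
  have h := Function.extend_smul c (Subtype.val : G → ℂ) f (0 : ℂ → ℂ)
  simpa [zeroExtend] using h

/-- The vector space of all holomorphic `f` on `G` with `sup_{z ∈ G} |f(z)| / v(z) < ∞`. -/
def weightedSubmodule {G : TopologicalSpace.Opens ℂ} (v : Weight G) :
    Submodule ℂ (G → ℂ) where
  carrier := {f | IsHolomorphic f ∧ BddAbove (range fun z => ‖f z‖ / v.toFun z)}
  zero_mem' := by
    refine ⟨?_, 0, ?_⟩
    · have h : zeroExtend (0 : G → ℂ) = 0 := by
        simpa using zeroExtend_smul (0 : ℂ) (0 : G → ℂ)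
      unfold IsHolomorphic
      rw [h]
      exact differentiableOn_const 0
    · rintro _ ⟨z, rfl⟩
      simp
  add_mem' := by
    rintro f g ⟨hf, A, hA⟩ ⟨hg, B, hB⟩
    refine ⟨?_, A + B, ?_⟩
    · unfold IsHolomorphic
      rw [zeroExtend_add]
      exact hf.add hg
    · rintro _ ⟨z, rfl⟩
      have h1 := hA ⟨z, rfl⟩
      have h2 := hB ⟨z, rfl⟩
      have h3 := div_le_div_of_nonneg_right (norm_add_le (f z) (g z)) (v.pos z).le
      simp only [Pi.add_apply] at *
      rw [add_div] at h3
      linarith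
  smul_mem' := by
    rintro c f ⟨hf, A, hA⟩
    refine ⟨?_, ‖c‖ * A, ?_⟩
    · unfold IsHolomorphic
      rw [zeroExtend_smul]
      exact hf.const_smul c
    · rintro _ ⟨z, rfl⟩
      have h1 := mul_le_mul_of_nonneg_left (hA ⟨z, rfl⟩) (norm_nonneg c)
      simpa [mul_div_assoc] using h1

/-- The space `H_v(G)`. It is a separate type so that its only topology is that of `‖·‖_v`,
and not pointwise convergence. -/
def WeightedSpace {G : TopologicalSpace.Opens ℂ} (v : Weight G) : Type :=
  weightedSubmodule v

namespace WeightedSpace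

variable {G : TopologicalSpace.Opens ℂ} {v : Weight G}

instance : AddCommGroup (WeightedSpace v) :=
  inferInstanceAs (AddCommGroup (weightedSubmodule v))

instance : Module ℂ (WeightedSpace v) :=
  inferInstanceAs (Module ℂ (weightedSubmodule v))

/-- The underlying function on `G`. -/
def fn (f : WeightedSpace v) : G → ℂ := f.1

/-- `‖f‖_v = sup_{z ∈ G} |f(z)| / v(z)`. -/
instance : Norm (WeightedSpace v) where
  norm f := ⨆ z : G, ‖f.fn z‖ / v.toFun z

theorem norm_def (f : WeightedSpace v) : ‖f‖ = ⨆ z : G, ‖f.fn z‖ / v.toFun z := rfl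

theorem fn_add (f g : WeightedSpace v) : (f + g).fn = f.fn + g.fn := rfl

theorem fn_smul (c : ℂ) (f : WeightedSpace v) : (c • f).fn = c • f.fn := rfl

theorem bdd (f : WeightedSpace v) : BddAbove (range fun z => ‖f.fn z‖ / v.toFun z) := f.2.2

theorem core : NormedSpace.Core ℂ (WeightedSpace v) where
  norm_nonneg f := Real.iSup_nonneg fun z => div_nonneg (norm_nonneg _) (v.pos z).le
  norm_smul c f := by
    rw [norm_def, norm_def, Real.mul_iSup_of_nonneg (norm_nonneg c)]
    simp [fn_smul, mul_div_assoc]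
  norm_triangle f g := by
    have hn : ∀ h : WeightedSpace v, 0 ≤ ‖h‖ := fun h =>
      Real.iSup_nonneg fun z => div_nonneg (norm_nonneg _) (v.pos z).le
    refine Real.iSup_le (fun z => ?_) (add_nonneg (hn f) (hn g))
    have h1 : ‖f.fn z‖ / v.toFun z ≤ ‖f‖ := le_ciSup f.bdd z
    have h2 : ‖g.fn z‖ / v.toFun z ≤ ‖g‖ := le_ciSup g.bdd z
    have h3 := div_le_div_of_nonneg_right (norm_add_le (f.fn z) (g.fn z)) (v.pos z).le
    rw [add_div] at h3
    rw [fn_add, Pi.add_apply]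
    linarith
  norm_eq_zero_iff f := by
    constructor
    · intro h
      refine Subtype.ext (funext fun z => ?_)
      have h1 : ‖f.fn z‖ / v.toFun z ≤ ‖f‖ := le_ciSup f.bdd z
      rw [h, div_le_iff₀ (v.pos z), zero_mul] at h1
      exact norm_le_zero_iff.mp h1
    · rintro rfl
      have : ∀ z, (0 : WeightedSpace v).fn z = 0 := fun _ => rfl
      simp [norm_def, this]

instance : NormedAddCommGroup (WeightedSpace v) := NormedAddCommGroup.ofCore core

instance : NormedSpace ℂ (WeightedSpace v) := NormedSpace.ofCore core

end WeightedSpace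

/-- The differentiation operator `D : f ↦ f'` is an epimorphism from `H_v(G)` to `H_w(G)`: it maps
`H_v(G)` into `H_w(G)`, is linear and continuous for the norms, and is onto. -/
def DiffIsEpimorphism {G : TopologicalSpace.Opens ℂ} (v w : Weight G) : Prop :=
  ∃ D : WeightedSpace v →L[ℂ] WeightedSpace w,
    (∀ f, (D f).fn = complexDeriv f.fn) ∧ Function.Surjective D

/-- The open unit disc. -/
def unitDisc : TopologicalSpace.Opens ℂ := ⟨Metric.ball 0 1, Metric.isOpen_ball⟩

/-- `v : [0,1) → (0,∞)` is the profile of a radial weight on the unit disc (the values of `v`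
outside `[0,1)` are irrelevant). -/
structure IsRadialDiscWeight (v : ℝ → ℝ) : Prop where
  pos : ∀ r ∈ Ico (0 : ℝ) 1, 0 < v r
  continuousOn : ContinuousOn v (Ico 0 1)
  monotoneOn : MonotoneOn v (Ico 0 1)
  tendsto : Tendsto v (𝓝[<] 1) atTop

theorem norm_mem_Ico_of_mem_unitDisc (z : unitDisc) : ‖(z : ℂ)‖ ∈ Ico (0 : ℝ) 1 :=
  ⟨norm_nonneg _, mem_ball_zero_iff.mp z.2⟩

/-- The weight `z ↦ v(|z|)` on the unit disc. -/
def IsRadialDiscWeight.toWeight {v : ℝ → ℝ} (hv : IsRadialDiscWeight v) : Weight unitDisc where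
  toFun z := v ‖(z : ℂ)‖
  pos z := hv.pos _ (norm_mem_Ico_of_mem_unitDisc z)
  continuous := hv.continuousOn.comp_continuous (continuous_norm.comp continuous_subtype_val)
    norm_mem_Ico_of_mem_unitDisc

/-- If `v` is a radial weight on the disc, then so is `w(r) = v(r) / (1 - r)`. -/
theorem IsRadialDiscWeight.div_one_sub {v : ℝ → ℝ} (hv : IsRadialDiscWeight v) :
    IsRadialDiscWeight fun r => v r / (1 - r) where
  pos r hr := div_pos (hv.pos r hr) (sub_pos.mpr hr.2)
  continuousOn := hv.continuousOn.div (by fun_prop) fun r hr => (sub_pos.mpr hr.2).ne'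
  monotoneOn r hr s hs h :=
    div_le_div₀ (hv.pos s hs).le (hv.monotoneOn hr hs h) (sub_pos.mpr hs.2) (by linarith)
  tendsto := by
    refine tendsto_atTop_mono' _ ?_ hv.tendsto
    filter_upwards [Ioo_mem_nhdsLT (zero_lt_one' ℝ)] with r hr
    rw [le_div_iff₀ (sub_pos.mpr hr.2)]
    have := hv.pos r ⟨hr.1.le, hr.2⟩
    nlinarith [hr.1]

/-- `v` is log-convex on `[0,1)`: the function `x ↦ log v(eˣ)` is convex on `(-∞, 0)`. -/
def IsLogConvexDisc (v : ℝ → ℝ) : Prop :=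
  ConvexOn ℝ (Iio 0) fun x => Real.log (v (Real.exp x))

/-- The right derivative of `v` at `r`. -/
def rightDeriv (v : ℝ → ℝ) (r : ℝ) : ℝ := derivWithin v (Ici r) r

/-- The quantity `(1 - r) v'(r) / v(r)`, as an extended real number, where `v'` is the right
derivative. -/
def growthQuotient (v : ℝ → ℝ) (r : ℝ) : EReal :=
  (((1 - r) * rightDeriv v r / v r : ℝ) : EReal)

end

/-!
Let `p r = r v'(r) / v(r)`, the right slope of the convex function `x ↦ log v(eˣ)` at `x = log r`.
The condition of the theorem says that `(1 - r) p r` stays between two positive constants near `1`,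
and convexity says that `v` lies above each of the power functions `s ↦ v r * (s / r) ^ p r`
tangent to it.

The upper bound is equivalent to the continuity of `D`. If it holds, then
`v ((1 + r) / 2) ≤ C * v r`, so Cauchy's estimate on discs of radius `(1 - r) / 2` applies.
Conversely, `zⁿ` with `n ≤ p r` attains its norm at some `|z| = s ≤ r`, where continuity of `D`
reads `n (1 - s) ≤ ‖D‖ s`.

Once `D` is continuous, the lower bound is equivalent to its surjectivity. If it holds, then `w` is
at most a multiple of `v'`, so that primitives of functions in `H_w` grow at most like `v`.
Conversely, for `n ≥ p r` the function `v r * zⁿ / (1 - z)` lies in the unit ball of `H_w`, while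
the primitive vanishing at `0` takes at `r` the value
`v r * ∑ k > n, rᵏ / k ≥ v r * (-log (n (1 - r)) - 1)`; by the open mapping theorem this is at most
a multiple of `v r`.
-/

open scoped BoundedContinuousFunction

section ZeroExtend

variable {G : TopologicalSpace.Opens ℂ}

theorem zeroExtend_apply (f : G → ℂ) (z : G) : zeroExtend f z = f z :=
  Subtype.val_injective.extend_apply f 0 z

theorem zeroExtend_restrict_eqOn (F : ℂ → ℂ) : EqOn (zeroExtend fun z : G => F z) F G :=
  fun z hz => zeroExtend_apply (fun z : G => F z) ⟨z, hz⟩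

theorem isHolomorphic_restrict {F : ℂ → ℂ} (hF : DifferentiableOn ℂ F G) :
    IsHolomorphic fun z : G => F z :=
  hF.congr (zeroExtend_restrict_eqOn F)

theorem complexDeriv_restrict_apply (F : ℂ → ℂ) (z : G) :
    complexDeriv (fun z : G => F z) z = deriv F z :=
  ((zeroExtend_restrict_eqOn F).eventuallyEq_of_mem (G.isOpen.mem_nhds z.2)).deriv_eq

namespace IsHolomorphic

variable {f g : G → ℂ}

theorem differentiableAt (hf : IsHolomorphic f) (z : G) :
    DifferentiableAt ℂ (zeroExtend f) z :=
  DifferentiableOn.differentiableAt hf (G.isOpen.mem_nhds z.2)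

protected theorem continuous (hf : IsHolomorphic f) : Continuous f := by
  have h := continuousOn_iff_continuous_domRestrict.mp (DifferentiableOn.continuousOn hf)
  exact h.congr (zeroExtend_apply f)

protected theorem complexDeriv (hf : IsHolomorphic f) : IsHolomorphic (complexDeriv f) :=
  isHolomorphic_restrict (DifferentiableOn.deriv hf G.isOpen)

theorem complexDeriv_add (hf : IsHolomorphic f) (hg : IsHolomorphic g) :
    complexDeriv (f + g) = complexDeriv f + complexDeriv g := by
  funext z
  simpa only [complexDeriv, zeroExtend_add] using!
    deriv_add (hf.differentiableAt z) (hg.differentiableAt z)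

theorem complexDeriv_smul (hf : IsHolomorphic f) (c : ℂ) :
    complexDeriv (c • f) = c • complexDeriv f := by
  funext z
  simpa only [complexDeriv, zeroExtend_smul] using!
    deriv_const_smul c (hf.differentiableAt z)

theorem of_tendstoLocallyUniformly {ι : Type*} {l : Filter ι} [l.NeBot] {F : ι → G → ℂ}
    (hF : ∀ i, IsHolomorphic (F i)) (hlim : TendstoLocallyUniformly F f l) : IsHolomorphic f := by
  have hlim' : TendstoLocallyUniformlyOn (fun i => zeroExtend (F i)) (zeroExtend f) l G := by
    rw [tendstoLocallyUniformlyOn_iff_tendstoLocallyUniformly_comp_coe]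
    simpa only [Function.comp_def, zeroExtend_apply] using hlim
  exact hlim'.differentiableOn (Eventually.of_forall hF) G.isOpen

end IsHolomorphic

end ZeroExtend

namespace WeightedSpace

variable {G : TopologicalSpace.Opens ℂ} {v w : Weight G}

theorem isHolomorphic (f : WeightedSpace v) : IsHolomorphic f.fn := f.2.1

theorem fn_injective : Function.Injective (fn : WeightedSpace v → G → ℂ) :=
  Subtype.val_injective

theorem norm_fn_le (f : WeightedSpace v) (z : G) : ‖f.fn z‖ ≤ ‖f‖ * v.toFun z :=
  (div_le_iff₀ (v.pos z)).mp (le_ciSup f.bdd z)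

theorem norm_le_of_forall_le {f : WeightedSpace v} {C : ℝ} (hC0 : 0 ≤ C)
    (hC : ∀ z, ‖f.fn z‖ ≤ C * v.toFun z) : ‖f‖ ≤ C :=
  Real.iSup_le (fun z => (div_le_iff₀ (v.pos z)).mpr (hC z)) hC0

/-- The element of `H_v(G)` given by a holomorphic function on `G` that is bounded by a multiple of
the weight. -/
def ofBound (f : G → ℂ) (hf : IsHolomorphic f) (C : ℝ) (hC : ∀ z, ‖f z‖ ≤ C * v.toFun z) :
    WeightedSpace v :=
  ⟨f, hf, C, forall_mem_range.mpr fun z => (div_le_iff₀ (v.pos z)).mpr (hC z)⟩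

/-- The isometric embedding `f ↦ f / v` of `H_v(G)` into the bounded continuous functions on `G`. -/
noncomputable def divWeight : WeightedSpace v →ₗᵢ[ℂ] (G →ᵇ ℂ) where
  toFun f := BoundedContinuousFunction.ofNormedAddCommGroup (fun z => f.fn z / v.toFun z)
    (f.isHolomorphic.continuous.div (Complex.continuous_ofReal.comp v.continuous)
      fun z => Complex.ofReal_ne_zero.mpr (v.pos z).ne') ‖f‖ fun z => by
    rw [norm_div, Complex.norm_of_nonneg (v.pos z).le, div_le_iff₀ (v.pos z)]
    exact f.norm_fn_le z
  map_add' f g := BoundedContinuousFunction.ext fun z => add_div (f.fn z) (g.fn z) _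
  map_smul' c f := BoundedContinuousFunction.ext fun z => mul_div_assoc c (f.fn z) _
  norm_map' f := by
    rw [BoundedContinuousFunction.norm_eq_iSup_norm, norm_def]
    refine iSup_congr fun z => ?_
    change ‖f.fn z / v.toFun z‖ = _
    rw [norm_div, Complex.norm_of_nonneg (v.pos z).le]

theorem divWeight_apply (f : WeightedSpace v) (z : G) : divWeight f z = f.fn z / v.toFun z := rfl

theorem weight_mul_divWeight (f : WeightedSpace v) :
    (fun z => (v.toFun z : ℂ) * divWeight f z) = f.fn := by
  funext z
  rw [divWeight_apply, mul_div_cancel₀ _ (Complex.ofReal_ne_zero.mpr (v.pos z).ne')]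

theorem mem_range_divWeight_iff {g : G →ᵇ ℂ} :
    g ∈ range (divWeight (v := v)) ↔ IsHolomorphic fun z => (v.toFun z : ℂ) * g z := by
  constructor
  · rintro ⟨f, rfl⟩
    rw [weight_mul_divWeight]
    exact f.isHolomorphic
  · intro hg
    have hbound : ∀ z, ‖(v.toFun z : ℂ) * g z‖ ≤ ‖g‖ * v.toFun z := fun z => by
      rw [norm_mul, Complex.norm_of_nonneg (v.pos z).le, mul_comm]
      exact mul_le_mul_of_nonneg_right (g.norm_coe_le_norm z) (v.pos z).le
    exact ⟨ofBound _ hg ‖g‖ hbound, BoundedContinuousFunction.ext fun z =>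
      mul_div_cancel_left₀ (g z) (Complex.ofReal_ne_zero.mpr (v.pos z).ne')⟩

theorem isClosed_range_divWeight : IsClosed (range (divWeight (v := v))) := by
  refine IsSeqClosed.isClosed fun u g hu hug => mem_range_divWeight_iff.mpr ?_
  have hconst : TendstoUniformly (fun (_ : ℕ) z => (v.toFun z : ℂ)) (fun z => v.toFun z) atTop :=
    fun _ hU => Eventually.of_forall fun _ _ => refl_mem_uniformity hU
  have hlim : TendstoLocallyUniformly (fun n z => (v.toFun z : ℂ) * u n z)
      (fun z => (v.toFun z : ℂ) * g z) atTop :=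
    hconst.tendstoLocallyUniformly.mul₀
      (BoundedContinuousFunction.tendsto_iff_tendstoUniformly.mp hug).tendstoLocallyUniformly
      (Complex.continuous_ofReal.comp v.continuous) g.continuous
  exact .of_tendstoLocallyUniformly (fun n => mem_range_divWeight_iff.mp (hu n)) hlim

instance : CompleteSpace (WeightedSpace v) :=
  divWeight.isometry.isUniformInducing.completeSpace isClosed_range_divWeight.isComplete

theorem exists_complexDeriv_clm_iff :
    (∃ D : WeightedSpace v →L[ℂ] WeightedSpace w, ∀ f, (D f).fn = complexDeriv f.fn) ↔
      ∃ C, 0 ≤ C ∧ ∀ (f : WeightedSpace v) (z : G),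
        ‖complexDeriv f.fn z‖ ≤ C * ‖f‖ * w.toFun z := by
  constructor
  · rintro ⟨D, hD⟩
    refine ⟨‖D‖, norm_nonneg D, fun f z => ?_⟩
    rw [← hD]
    exact ((D f).norm_fn_le z).trans
      (mul_le_mul_of_nonneg_right (D.le_opNorm f) (w.pos z).le)
  · rintro ⟨C, hC0, hC⟩
    let D : WeightedSpace v →ₗ[ℂ] WeightedSpace w :=
      { toFun := fun f => ofBound (complexDeriv f.fn) f.isHolomorphic.complexDeriv _ (hC f)
        map_add' := fun f g =>
          fn_injective (f.isHolomorphic.complexDeriv_add g.isHolomorphic)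
        map_smul' := fun c f => fn_injective (f.isHolomorphic.complexDeriv_smul c) }
    exact ⟨D.mkContinuous C fun f => norm_le_of_forall_le (by positivity) (hC f), fun _ => rfl⟩

end WeightedSpace

section RealAnalysis

theorem exists_forall_Ico_of_eventually_nhdsLT {α : Type*} [LinearOrder α] [TopologicalSpace α]
    [OrderTopology α] [DenselyOrdered α] {a b : α} (hab : a < b) {P : α → Prop}
    (h : ∀ᶠ x in 𝓝[<] b, P x) : ∃ c ∈ Ioo a b, ∀ x ∈ Ico c b, P x := by
  obtain ⟨l, ⟨hal, hlb⟩, hP⟩ := (mem_nhdsLT_iff_exists_mem_Ico_Ioo_subset hab).mp h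
  obtain ⟨c, hlc, hcb⟩ := exists_between hlb
  exact ⟨c, ⟨hal.trans_lt hlc, hcb⟩, fun x hx => hP ⟨hlc.trans_le hx.1, hx.2⟩⟩

theorem bddAbove_image_Ico_of_eventually_le {α β : Type*} [LinearOrder α] [TopologicalSpace α]
    [OrderTopology α] [DenselyOrdered α] [CompactIccSpace α] [LinearOrder β] [TopologicalSpace β]
    [ClosedIciTopology β] {f : α → β} {a b : α} {M : β} (hab : a < b)
    (hf : ContinuousOn f (Ico a b)) (hM : ∀ᶠ x in 𝓝[<] b, f x ≤ M) :
    BddAbove (f '' Ico a b) := by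
  obtain ⟨c, hc, hcM⟩ := exists_forall_Ico_of_eventually_nhdsLT hab hM
  have : Nonempty β := ⟨M⟩
  have hcompact : BddAbove (f '' Icc a c) :=
    isCompact_Icc.bddAbove_image (hf.mono (Icc_subset_Ico_right hc.2))
  have hnear : BddAbove (f '' Ico c b) := ⟨M, forall_mem_image.mpr hcM⟩
  refine (hcompact.union hnear).mono ?_
  rw [← image_union, Icc_union_Ico_eq_Ico hc.1.le hc.2]

theorem tangent_le_of_convexOn {S : Set ℝ} {f : ℝ → ℝ} (hf : ConvexOn ℝ S f) {x y : ℝ}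
    (hx : x ∈ interior S) (hy : y ∈ S) :
    f x + derivWithin f (Ioi x) x * (y - x) ≤ f y := by
  rcases lt_trichotomy x y with hxy | rfl | hyx
  · have hslope := hf.rightDeriv_le_slope_of_mem_interior hx hy hxy
    rw [slope_def_field, le_div_iff₀ (sub_pos.mpr hxy)] at hslope
    linarith
  · simp
  · have hslope := (hf.slope_le_leftDeriv_of_mem_interior hy hx hyx).trans
      (hf.leftDeriv_le_rightDeriv_of_mem_interior hx)
    rw [slope_def_field, div_le_iff₀ (sub_pos.mpr hyx)] at hslope
    linarith

theorem limsup_coe_lt_top_iff {α : Type*} {l : Filter α} {f : α → ℝ} :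
    limsup (fun x => (f x : EReal)) l < ⊤ ↔ ∃ M : ℝ, ∀ᶠ x in l, f x ≤ M := by
  constructor
  · intro h
    obtain ⟨M, hM, -⟩ := EReal.lt_iff_exists_real_btwn.mp h
    exact ⟨M, (eventually_lt_of_limsup_lt hM).mono fun x hx => (EReal.coe_lt_coe_iff.mp hx).le⟩
  · rintro ⟨M, hM⟩
    refine (limsup_le_of_le (by isBoundedDefault) ?_).trans_lt (EReal.coe_lt_top M)
    exact hM.mono fun x hx => EReal.coe_le_coe_iff.mpr hx

theorem coe_lt_liminf_coe_iff {α : Type*} {l : Filter α} {f : α → ℝ} {a : ℝ} :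
    (a : EReal) < liminf (fun x => (f x : EReal)) l ↔ ∃ c > a, ∀ᶠ x in l, c ≤ f x := by
  constructor
  · intro h
    obtain ⟨c, hac, hc⟩ := EReal.lt_iff_exists_real_btwn.mp h
    exact ⟨c, EReal.coe_lt_coe_iff.mp hac,
      (eventually_lt_of_lt_liminf hc).mono fun x hx => (EReal.coe_lt_coe_iff.mp hx).le⟩
  · rintro ⟨c, hac, hc⟩
    refine (EReal.coe_lt_coe_iff.mpr hac).trans_le (le_liminf_of_le (by isBoundedDefault) ?_)
    exact hc.mono fun x hx => EReal.coe_le_coe_iff.mpr hx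

theorem norm_le_of_norm_fderiv_le_deriv_right_norm {E F : Type*} [NormedAddCommGroup E]
    [NormedSpace ℝ E] [NormedAddCommGroup F] [NormedSpace ℝ F] {f : E → F} {f' : E → E →L[ℝ] F}
    {B B' : ℝ → ℝ} {a R : ℝ} (ha : 0 ≤ a) (hf : ∀ z ∈ Metric.ball 0 R, HasFDerivAt f (f' z) z)
    (hfa : ∀ z, ‖z‖ = a → ‖f z‖ ≤ B a) (hB : ContinuousOn B (Ico a R))
    (hB' : ∀ t ∈ Ico a R, HasDerivWithinAt B (B' t) (Ici t) t)
    (hbound : ∀ z, ‖z‖ ∈ Ico a R → ‖f' z‖ ≤ B' ‖z‖) {z : E} (hz : ‖z‖ ∈ Ico a R) :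
    ‖f z‖ ≤ B ‖z‖ := by
  rcases eq_or_ne z 0 with rfl | hz0
  · have ha0 : ‖(0 : E)‖ = a := le_antisymm (norm_zero.trans_le ha) hz.1
    exact (hfa 0 ha0).trans_eq (by rw [ha0])
  obtain ⟨u, hu, huz⟩ : ∃ u : E, ‖u‖ = 1 ∧ ‖z‖ • u = z :=
    ⟨‖z‖⁻¹ • z, by rw [norm_smul, norm_inv, norm_norm, inv_mul_cancel₀ (norm_ne_zero_iff.mpr hz0)],
      smul_inv_smul₀ (norm_ne_zero_iff.mpr hz0) z⟩
  have hnorm : ∀ t ∈ Icc a ‖z‖, ‖t • u‖ = t := fun t ht => by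
    rw [norm_smul, hu, mul_one, Real.norm_of_nonneg (ha.trans ht.1)]
  have hmem : ∀ t ∈ Icc a ‖z‖, ‖t • u‖ ∈ Ico a R := fun t ht => by
    rw [hnorm t ht]
    exact ⟨ht.1, ht.2.trans_lt hz.2⟩
  have hder : ∀ t ∈ Icc a ‖z‖, HasDerivAt (fun t : ℝ => f (t • u)) (f' (t • u) u) t :=
    fun t ht => (hf _ (mem_ball_zero_iff.mpr (hmem t ht).2)).comp_hasDerivAt t
      (by simpa using (hasDerivAt_id t).smul_const u)
  have hsub : Icc a ‖z‖ ⊆ Ico a R := Icc_subset_Ico_right hz.2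
  have hray := image_norm_le_of_norm_deriv_right_le_deriv_boundary'
    (fun t ht => (hder t ht).continuousAt.continuousWithinAt)
    (fun t ht => (hder t (Ico_subset_Icc_self ht)).hasDerivWithinAt)
    (hfa _ (hnorm a (left_mem_Icc.mpr hz.1))) (hB.mono hsub)
    (fun t ht => hB' t (hsub (Ico_subset_Icc_self ht)))
    (fun t ht => by
      have ht' := Ico_subset_Icc_self ht
      calc ‖f' (t • u) u‖ ≤ ‖f' (t • u)‖ * ‖u‖ := (f' (t • u)).le_opNorm u
        _ ≤ B' t := by
          rw [hu, mul_one]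
          simpa only [hnorm t ht'] using hbound _ (hmem t ht'))
    (right_mem_Icc.mpr hz.1)
  rwa [huz] at hray

end RealAnalysis

/-- The right slope `r v'(r) / v(r)` of the function `x ↦ log v(eˣ)` at `x = log r`. -/
noncomputable def logSlope (v : ℝ → ℝ) (r : ℝ) : ℝ := r * rightDeriv v r / v r

section LogSlope

variable {v : ℝ → ℝ}

theorem limsup_growthQuotient_lt_top_iff :
    limsup (growthQuotient v) (𝓝[<] 1) < ⊤ ↔
      ∃ M : ℝ, ∀ᶠ r in 𝓝[<] 1, (1 - r) * logSlope v r ≤ M := by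
  have hnear : ∀ᶠ r in 𝓝[<] (1 : ℝ), r ∈ Ioo (1 / 2) 1 := Ioo_mem_nhdsLT (by norm_num)
  refine limsup_coe_lt_top_iff.trans ⟨?_, ?_⟩ <;> rintro ⟨M, hM⟩
  · refine ⟨|M|, ?_⟩
    filter_upwards [hM, hnear] with r hr hr1
    calc (1 - r) * logSlope v r = r * ((1 - r) * rightDeriv v r / v r) := by rw [logSlope]; ring
      _ ≤ r * |M| := mul_le_mul_of_nonneg_left (hr.trans (le_abs_self M)) (by linarith [hr1.1])
      _ ≤ |M| := mul_le_of_le_one_left (abs_nonneg M) hr1.2.le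
  · refine ⟨2 * |M|, ?_⟩
    filter_upwards [hM, hnear] with r hr hr1
    have hr0 : 0 < r := by linarith [hr1.1]
    calc (1 - r) * rightDeriv v r / v r = (1 - r) * logSlope v r / r := by
          rw [logSlope]; field_simp
      _ ≤ |M| / r := div_le_div_of_nonneg_right (hr.trans (le_abs_self M)) hr0.le
      _ ≤ 2 * |M| := by
          rw [div_le_iff₀ hr0]
          nlinarith [abs_nonneg M, hr1.1]

theorem liminf_growthQuotient_pos_iff :
    0 < liminf (growthQuotient v) (𝓝[<] 1) ↔
      ∃ c > (0 : ℝ), ∀ᶠ r in 𝓝[<] 1, c ≤ (1 - r) * logSlope v r := by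
  have hnear : ∀ᶠ r in 𝓝[<] (1 : ℝ), r ∈ Ioo (1 / 2) 1 := Ioo_mem_nhdsLT (by norm_num)
  refine coe_lt_liminf_coe_iff.trans ⟨?_, ?_⟩ <;> rintro ⟨c, hc0, hc⟩
  · refine ⟨c / 2, half_pos hc0, ?_⟩
    filter_upwards [hc, hnear] with r hr hr1
    calc c / 2 ≤ r * c := by nlinarith [hr1.1]
      _ ≤ r * ((1 - r) * rightDeriv v r / v r) :=
          mul_le_mul_of_nonneg_left hr (by linarith [hr1.1])
      _ = (1 - r) * logSlope v r := by rw [logSlope]; ring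
  · refine ⟨c, hc0, ?_⟩
    filter_upwards [hc, hnear] with r hr hr1
    have hr0 : 0 < r := by linarith [hr1.1]
    calc c ≤ c / r := le_div_self hc0.le hr0 hr1.2.le
      _ ≤ (1 - r) * logSlope v r / r := div_le_div_of_nonneg_right hr hr0.le
      _ = (1 - r) * rightDeriv v r / v r := by rw [logSlope]; field_simp

theorem rightDeriv_nonneg_of_monotoneOn {r b : ℝ} (hrb : r < b)
    (hmono : MonotoneOn v (Ico r b)) : 0 ≤ rightDeriv v r := by
  have h : derivWithin v (Ico r b) r = rightDeriv v r :=
    derivWithin_congr_set ((Ici_inter_Iio (a := r) (b := b)) ▸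
      inter_eventuallyEq_left.mpr (eventually_of_mem (Iio_mem_nhds hrb) fun _ hs _ => hs))
  exact h ▸ hmono.derivWithin_nonneg

theorem logSlope_nonneg (hpos : ∀ r ∈ Ico (0 : ℝ) 1, 0 < v r)
    (hmono : MonotoneOn v (Ico 0 1)) {r : ℝ} (hr : r ∈ Ico (0 : ℝ) 1) : 0 ≤ logSlope v r :=
  div_nonneg (mul_nonneg hr.1 (rightDeriv_nonneg_of_monotoneOn hr.2
    (hmono.mono (Ico_subset_Ico_left hr.1)))) (hpos r hr).le

theorem div_one_sub_le_rightDeriv_div (hpos : ∀ r ∈ Ico (0 : ℝ) 1, 0 < v r)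
    (hmono : MonotoneOn v (Ico 0 1)) {r : ℝ} (hr : r ∈ Ico (0 : ℝ) 1) {c : ℝ} (hc0 : 0 < c)
    (hc : c ≤ (1 - r) * logSlope v r) : v r / (1 - r) ≤ rightDeriv v r / c := by
  have hderiv : 0 ≤ rightDeriv v r := rightDeriv_nonneg_of_monotoneOn hr.2
    (hmono.mono (Ico_subset_Ico_left hr.1))
  have hr1 : 0 < 1 - r := sub_pos.mpr hr.2
  rw [logSlope, mul_div_assoc', le_div_iff₀ (hpos r hr)] at hc
  rw [div_le_div_iff₀ hr1 hc0]
  calc v r * c = c * v r := mul_comm _ _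
    _ ≤ (1 - r) * (r * rightDeriv v r) := hc
    _ ≤ (1 - r) * rightDeriv v r :=
        mul_le_mul_of_nonneg_left (mul_le_of_le_one_left hderiv hr.2.le) hr1.le
    _ = rightDeriv v r * (1 - r) := mul_comm _ _

namespace IsLogConvexDisc

variable (hpos : ∀ r ∈ Ico (0 : ℝ) 1, 0 < v r) (hlc : IsLogConvexDisc v) {r s : ℝ}

include hpos hlc

theorem hasDerivWithinAt_rightDeriv (hr : r ∈ Ioo (0 : ℝ) 1) :
    HasDerivWithinAt v (rightDeriv v r) (Ici r) r := by
  have hint : Real.log r ∈ interior (Iio (0 : ℝ)) := by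
    rw [interior_Iio]
    exact Real.log_neg hr.1 hr.2
  have hlog : DifferentiableWithinAt ℝ (fun s => Real.log (v (Real.exp (Real.log s))))
      (Ici r) r :=
    (hlc.hasDerivWithinAt_rightDeriv_of_mem_interior hint).Ici_of_Ioi.differentiableWithinAt.comp r
      (Real.differentiableAt_log hr.1.ne').differentiableWithinAt
      fun s hs => Real.log_le_log hr.1 hs
  have heq : ∀ s ∈ Ico r 1, v s = Real.exp (Real.log (v (Real.exp (Real.log s)))) :=
    fun s hs => by
      have hs0 : 0 < s := hr.1.trans_le hs.1
      rw [Real.exp_log hs0, Real.exp_log (hpos s ⟨hs0.le, hs.2⟩)]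
  have hv : DifferentiableWithinAt ℝ v (Ici r) r :=
    hlog.exp.congr_of_eventuallyEq (eventually_of_mem (Ico_mem_nhdsGE hr.2) heq)
      (heq r ⟨le_rfl, hr.2⟩)
  exact hv.hasDerivWithinAt

theorem derivWithin_log_comp_exp (hr : r ∈ Ioo (0 : ℝ) 1) :
    derivWithin (fun x => Real.log (v (Real.exp x))) (Ioi (Real.log r)) (Real.log r) =
      logSlope v r := by
  have hexp : Real.exp (Real.log r) = r := Real.exp_log hr.1
  have hv := hlc.hasDerivWithinAt_rightDeriv hpos hr
  rw [← hexp] at hv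
  have hcomp := (hv.comp (s := Ioi (Real.log r)) (Real.log r)
    (Real.hasDerivAt_exp _).hasDerivWithinAt fun x hx => Real.exp_le_exp.mpr (le_of_lt hx)).log
      (by simpa only [Function.comp_apply, hexp] using (hpos r ⟨hr.1.le, hr.2⟩).ne')
  have hslope := hcomp.derivWithin (uniqueDiffWithinAt_Ioi _)
  rwa [Function.comp_apply, hexp, mul_comm] at hslope

theorem mul_div_rpow_logSlope_le (hr : r ∈ Ioo (0 : ℝ) 1) (hs : s ∈ Ioo (0 : ℝ) 1) :
    v r * (s / r) ^ logSlope v r ≤ v s := by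
  have hvr := hpos r ⟨hr.1.le, hr.2⟩
  have hsr : 0 < s / r := div_pos hs.1 hr.1
  have hint : Real.log r ∈ interior (Iio (0 : ℝ)) := by
    rw [interior_Iio]
    exact Real.log_neg hr.1 hr.2
  have htangent := tangent_le_of_convexOn hlc hint (mem_Iio.mpr (Real.log_neg hs.1 hs.2))
  rw [hlc.derivWithin_log_comp_exp hpos hr, Real.exp_log hr.1, Real.exp_log hs.1,
    ← Real.log_div hs.1.ne' hr.1.ne'] at htangent
  rwa [← Real.log_le_log_iff (by positivity) (hpos s ⟨hs.1.le, hs.2⟩),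
    Real.log_mul hvr.ne' (by positivity), Real.log_rpow hsr]

theorem pow_mul_le_pow_mul {n : ℕ} (hn : n ≤ logSlope v r) (hr : r ∈ Ioo (0 : ℝ) 1)
    (hs : s ∈ Ico r 1) : s ^ n * v r ≤ r ^ n * v s := by
  have hr0 := hr.1
  have hvr := hpos r ⟨hr.1.le, hr.2⟩
  calc s ^ n * v r = r ^ n * (v r * (s / r) ^ n) := by rw [div_pow]; field_simp
    _ ≤ r ^ n * (v r * (s / r) ^ logSlope v r) := by
      rw [← Real.rpow_natCast (s / r)]
      gcongr
      exact (one_le_div hr0).mpr hs.1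
    _ ≤ r ^ n * v s := by
      gcongr
      exact hlc.mul_div_rpow_logSlope_le hpos hr ⟨hr0.trans_le hs.1, hs.2⟩

theorem mul_pow_le (hmono : MonotoneOn v (Ico 0 1)) {n : ℕ} (hn0 : n ≠ 0)
    (hn : logSlope v r ≤ n) (hr : r ∈ Ioo (0 : ℝ) 1) (hs : s ∈ Ico (0 : ℝ) 1) :
    v r * s ^ n ≤ v s := by
  rcases hs.1.eq_or_lt with rfl | hs0
  · simpa [hn0] using (hpos 0 hs).le
  have hvr := hpos r ⟨hr.1.le, hr.2⟩
  have hsr : s ≤ s / r := le_div_self hs.1 hr.1 hr.2.le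
  have hslope := logSlope_nonneg hpos hmono ⟨hr.1.le, hr.2⟩
  calc v r * s ^ n ≤ v r * s ^ logSlope v r := by
        rw [← Real.rpow_natCast s]
        exact mul_le_mul_of_nonneg_left
          (Real.rpow_le_rpow_of_exponent_ge hs0 hs.2.le hn) hvr.le
    _ ≤ v r * (s / r) ^ logSlope v r := by gcongr
    _ ≤ v s := hlc.mul_div_rpow_logSlope_le hpos hr ⟨hs0, hs.2⟩

theorem exists_isMaxOn_pow_div (hv : ContinuousOn v (Ico 0 1)) {n : ℕ} (hn0 : n ≠ 0)
    (hn : n ≤ logSlope v r) (hr : r ∈ Ioo (0 : ℝ) 1) :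
    ∃ s ∈ Ioc 0 r, IsMaxOn (fun t => t ^ n / v t) (Ico 0 1) s := by
  have hsub : Icc 0 r ⊆ Ico (0 : ℝ) 1 := Icc_subset_Ico_right hr.2
  have hvr := hpos r ⟨hr.1.le, hr.2⟩
  have hcont : ContinuousOn (fun t => t ^ n / v t) (Icc 0 r) :=
    (continuousOn_pow n).div (hv.mono hsub) fun t ht => (hpos t (hsub ht)).ne'
  obtain ⟨s, hs, hmax⟩ := isCompact_Icc.exists_isMaxOn (nonempty_Icc.mpr hr.1.le) hcont
  have hmax_r : r ^ n / v r ≤ s ^ n / v s := hmax (right_mem_Icc.mpr hr.1.le)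
  have hs0 : s ≠ 0 := by
    rintro rfl
    have : 0 < r ^ n / v r := div_pos (pow_pos hr.1 n) hvr
    rw [zero_pow hn0, zero_div] at hmax_r
    linarith
  refine ⟨s, ⟨hs.1.lt_of_ne' hs0, hs.2⟩, fun t ht => ?_⟩
  rcases le_total t r with htr | hrt
  · exact hmax ⟨ht.1, htr⟩
  · have htail : t ^ n / v t ≤ r ^ n / v r := by
      rw [div_le_div_iff₀ (hpos t ht) hvr]
      exact hlc.pow_mul_le_pow_mul hpos hn hr ⟨hrt, ht.2⟩
    exact htail.trans hmax_r

theorem le_exp_two_mul_mul (hmono : MonotoneOn v (Ico 0 1)) {M : ℝ} (hr : r ∈ Ico (1 / 2 : ℝ) 1)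
    (hM : (1 - (1 + r) / 2) * logSlope v ((1 + r) / 2) ≤ M) :
    v ((1 + r) / 2) ≤ Real.exp (2 * M) * v r := by
  set s := (1 + r) / 2 with hs
  have hr0 : 0 < r := by linarith [hr.1]
  have hs01 : s ∈ Ioo (0 : ℝ) 1 := ⟨by linarith, by linarith [hr.2]⟩
  have hslope := logSlope_nonneg hpos hmono ⟨hs01.1.le, hs01.2⟩
  have hM0 : 0 ≤ M := (mul_nonneg (sub_pos.mpr hs01.2).le hslope).trans hM
  have hrs : 0 < r / s := div_pos hr0 hs01.1
  have hpow : (s / r) ^ logSlope v s ≤ Real.exp (2 * M) :=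
    calc (s / r) ^ logSlope v s ≤ Real.exp (s / r - 1) ^ logSlope v s := by
          have := Real.add_one_le_exp (s / r - 1)
          have := hs01.1
          gcongr
          linarith
      _ = Real.exp ((1 - s) * logSlope v s / r) := by
          rw [← Real.exp_mul]
          congr 1
          field_simp
          rw [hs]
          ring
      _ ≤ Real.exp (2 * M) := by
          rw [Real.exp_le_exp, div_le_iff₀ hr0]
          nlinarith [hr.1]
  calc v s = (s / r) ^ logSlope v s * (v s * (r / s) ^ logSlope v s) := by
        rw [← inv_div r s, Real.inv_rpow hrs.le]
        field_simp
    _ ≤ Real.exp (2 * M) * v r :=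
        mul_le_mul hpow (hlc.mul_div_rpow_logSlope_le hpos hs01 ⟨hr0, hr.2⟩)
          (mul_nonneg (hpos s ⟨hs01.1.le, hs01.2⟩).le (by positivity)) (Real.exp_nonneg _)

theorem exists_forall_map_add_one_div_two_le (hv : ContinuousOn v (Ico 0 1))
    (hmono : MonotoneOn v (Ico 0 1))
    (h : ∃ M : ℝ, ∀ᶠ r in 𝓝[<] 1, (1 - r) * logSlope v r ≤ M) :
    ∃ C, 0 ≤ C ∧ ∀ r ∈ Ico (0 : ℝ) 1, v ((1 + r) / 2) ≤ C * v r := by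
  obtain ⟨M, hM⟩ := h
  obtain ⟨a, ha, hM⟩ := exists_forall_Ico_of_eventually_nhdsLT one_half_lt_one hM
  have hmid : MapsTo (fun r : ℝ => (1 + r) / 2) (Ico 0 1) (Ico 0 1) :=
    fun r hr => ⟨by linarith [hr.1], by linarith [hr.2]⟩
  have hcont : ContinuousOn (fun r => v ((1 + r) / 2) / v r) (Ico 0 1) :=
    (hv.comp (by fun_prop) hmid).div hv fun r hr => (hpos r hr).ne'
  have hnear : ∀ᶠ r in 𝓝[<] 1, v ((1 + r) / 2) / v r ≤ Real.exp (2 * M) := by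
    filter_upwards [Ioo_mem_nhdsLT ha.2] with r hr
    have hr1 : r ∈ Ico (1 / 2 : ℝ) 1 := ⟨(ha.1.trans hr.1).le, hr.2⟩
    rw [div_le_iff₀ (hpos r ⟨by linarith [hr1.1], hr.2⟩)]
    exact hlc.le_exp_two_mul_mul hpos hmono hr1
      (hM _ ⟨by linarith [hr.1, hr.2], by linarith [hr.2]⟩)
  obtain ⟨C, hC⟩ := bddAbove_image_Ico_of_eventually_le one_pos hcont hnear
  refine ⟨|C|, abs_nonneg C, fun r hr => ?_⟩
  exact (div_le_iff₀ (hpos r hr)).mp ((hC (mem_image_of_mem _ hr)).trans (le_abs_self C))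

end IsLogConvexDisc

end LogSlope

section NegLogTail

/-- The tail `∑ k > n, zᵏ / k` of the power series of `-log (1 - z)`, written in closed form: the
primitive of `zⁿ / (1 - z)` on the unit disc vanishing at `0`. -/
noncomputable def negLogTail (n : ℕ) (z : ℂ) : ℂ :=
  -(Complex.log (1 + -z) - Complex.logTaylor (n + 1) (-z))

theorem negLogTail_zero (n : ℕ) : negLogTail n 0 = 0 := by
  simp [negLogTail, Complex.logTaylor_at_zero]

theorem one_sub_mem_slitPlane {z : ℂ} (hz : z ∈ unitDisc) : 1 - z ∈ Complex.slitPlane := by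
  have hz1 : ‖-z‖ < 1 := by rw [norm_neg]; exact mem_ball_zero_iff.mp hz
  simpa only [sub_eq_add_neg] using Complex.mem_slitPlane_of_norm_lt_one hz1

theorem hasDerivAt_negLogTail (n : ℕ) {z : ℂ} (hz : z ∈ unitDisc) :
    HasDerivAt (negLogTail n) (z ^ n * (1 - z)⁻¹) z := by
  have hslit : 1 + -z ∈ Complex.slitPlane := sub_eq_add_neg 1 z ▸ one_sub_mem_slitPlane hz
  have h := ((Complex.hasDerivAt_log_sub_logTaylor n hslit).scomp z (hasDerivAt_neg z)).neg
  simpa [negLogTail, Function.comp_def, ← sub_eq_add_neg] using! h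

theorem negLogTail_ofReal (n : ℕ) {r : ℝ} (hr : r ≤ 1) :
    negLogTail n r =
      ((-Real.log (1 - r) - ∑ k ∈ Finset.range n, r ^ (k + 1) / (k + 1) : ℝ) : ℂ) := by
  have hterm : ∀ k : ℕ, (-1 : ℂ) ^ (k + 1 + 1) * (-(r : ℂ)) ^ (k + 1) / (k + 1 : ℕ) =
      -((r : ℂ) ^ (k + 1) / (k + 1)) := fun k => by
    rw [neg_pow (r : ℂ), ← mul_assoc, ← pow_add, Odd.neg_one_pow ⟨k + 1, by ring⟩]
    push_cast
    ring
  have htaylor : Complex.logTaylor (n + 1) (-(r : ℂ)) =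
      -∑ k ∈ Finset.range n, (r : ℂ) ^ (k + 1) / (k + 1) := by
    rw [Complex.logTaylor, Finset.sum_range_succ', Finset.sum_congr rfl fun k _ => hterm k]
    simp
  rw [negLogTail, htaylor, ← sub_eq_add_neg, sub_neg_eq_add]
  push_cast [Complex.ofReal_log (sub_nonneg.mpr hr)]
  ring

theorem neg_log_mul_one_sub_sub_one_le_norm_negLogTail {n : ℕ} (hn : n ≠ 0) {r : ℝ}
    (hr : r ∈ Ico (0 : ℝ) 1) : -Real.log (n * (1 - r)) - 1 ≤ ‖negLogTail n r‖ := by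
  have hsum : ∑ k ∈ Finset.range n, r ^ (k + 1) / (k + 1) ≤ 1 + Real.log n :=
    calc ∑ k ∈ Finset.range n, r ^ (k + 1) / (k + 1) ≤ (harmonic n : ℝ) := by
          rw [harmonic]
          push_cast
          refine Finset.sum_le_sum fun k _ => ?_
          rw [div_eq_mul_inv]
          exact mul_le_of_le_one_left (by positivity) (pow_le_one₀ hr.1 hr.2.le)
      _ ≤ 1 + Real.log n := harmonic_le_one_add_log n
  rw [negLogTail_ofReal n hr.2.le, Complex.norm_real,
    Real.log_mul (Nat.cast_ne_zero.mpr hn) (sub_pos.mpr hr.2).ne']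
  exact le_trans (by linarith) (Real.le_norm_self _)

end NegLogTail

theorem ofReal_mem_unitDisc {r : ℝ} (hr : r ∈ Ico (0 : ℝ) 1) : (r : ℂ) ∈ unitDisc :=
  mem_ball_zero_iff.mpr ((Complex.norm_of_nonneg hr.1).trans_lt hr.2)

/-- The weight `V` on the unit disc is the radial weight `z ↦ v(|z|)`. -/
def Weight.HasProfile (V : Weight unitDisc) (v : ℝ → ℝ) : Prop :=
  ∀ z : unitDisc, V.toFun z = v ‖(z : ℂ)‖

namespace Weight.HasProfile

variable {v : ℝ → ℝ} {V W : Weight unitDisc}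

theorem apply_ofReal (hV : V.HasProfile v) {r : ℝ} (hr : r ∈ Ico (0 : ℝ) 1) :
    V.toFun ⟨r, ofReal_mem_unitDisc hr⟩ = v r := by
  rw [hV, Complex.norm_of_nonneg hr.1]

theorem pos (hV : V.HasProfile v) : ∀ r ∈ Ico (0 : ℝ) 1, 0 < v r := fun _ hr =>
  hV.apply_ofReal hr ▸ V.pos _

theorem continuousOn (hV : V.HasProfile v) : ContinuousOn v (Ico 0 1) := by
  rw [continuousOn_iff_continuous_domRestrict]
  have h : Continuous fun r : Ico (0 : ℝ) 1 => V.toFun ⟨(r : ℝ), ofReal_mem_unitDisc r.2⟩ :=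
    V.continuous.comp (by fun_prop)
  exact h.congr fun r => hV.apply_ofReal r.2

theorem norm_complexDeriv_le (hV : V.HasProfile v) (hW : W.HasProfile fun r => v r / (1 - r))
    (hmono : MonotoneOn v (Ico 0 1)) {C : ℝ}
    (hC : ∀ r ∈ Ico (0 : ℝ) 1, v ((1 + r) / 2) ≤ C * v r) (f : WeightedSpace V)
    (z : unitDisc) : ‖complexDeriv f.fn z‖ ≤ 2 * C * ‖f‖ * W.toFun z := by
  have hr := norm_mem_Ico_of_mem_unitDisc z
  rw [hW]
  set r := ‖(z : ℂ)‖
  have hr1 : 0 < 1 - r := sub_pos.mpr hr.2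
  have hmid : (1 + r) / 2 ∈ Ico (0 : ℝ) 1 := ⟨by linarith [hr.1], by linarith [hr.2]⟩
  have hnorm : ∀ ζ ∈ Metric.closedBall (z : ℂ) ((1 - r) / 2), ‖ζ‖ ≤ (1 + r) / 2 := fun ζ hζ => by
    have hdist := mem_closedBall_iff_norm.mp hζ
    have htri : ‖ζ‖ ≤ ‖ζ - z‖ + r := norm_le_norm_sub_add ζ z
    linarith
  have hsub : Metric.closedBall (z : ℂ) ((1 - r) / 2) ⊆ (unitDisc : Set ℂ) := fun ζ hζ =>
    mem_ball_zero_iff.mpr ((hnorm ζ hζ).trans_lt hmid.2)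
  have hbound : ∀ ζ ∈ Metric.sphere (z : ℂ) ((1 - r) / 2),
      ‖zeroExtend f.fn ζ‖ ≤ ‖f‖ * (C * v r) := fun ζ hζ => by
    have hζ' := Metric.sphere_subset_closedBall hζ
    let ζD : unitDisc := ⟨ζ, hsub hζ'⟩
    calc ‖zeroExtend f.fn ζ‖ = ‖f.fn ζD‖ := by rw [← zeroExtend_apply f.fn ζD]
      _ ≤ ‖f‖ * v ‖ζ‖ := (f.norm_fn_le ζD).trans_eq (by rw [hV])
      _ ≤ ‖f‖ * v ((1 + r) / 2) := mul_le_mul_of_nonneg_left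
          (hmono (norm_mem_Ico_of_mem_unitDisc ζD) hmid (hnorm ζ hζ')) (norm_nonneg f)
      _ ≤ ‖f‖ * (C * v r) := mul_le_mul_of_nonneg_left (hC r hr) (norm_nonneg f)
  calc ‖complexDeriv f.fn z‖ ≤ ‖f‖ * (C * v r) / ((1 - r) / 2) :=
        Complex.norm_deriv_le_of_forall_mem_sphere_norm_le (half_pos hr1)
          (DifferentiableOn.diffContOnCl_ball f.isHolomorphic hsub) hbound
    _ = 2 * C * ‖f‖ * (v r / (1 - r)) := by field_simp

theorem natCast_mul_one_sub_le_of_isMaxOn (hV : V.HasProfile v)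
    (hW : W.HasProfile fun r => v r / (1 - r)) {C : ℝ} (hC0 : 0 ≤ C)
    (hC : ∀ (f : WeightedSpace V) (z : unitDisc), ‖complexDeriv f.fn z‖ ≤ C * ‖f‖ * W.toFun z)
    {n : ℕ} {s : ℝ} (hs : s ∈ Ioo (0 : ℝ) 1)
    (hmax : IsMaxOn (fun t => t ^ n / v t) (Ico 0 1) s) : n * (1 - s) ≤ C * s := by
  have hs' : s ∈ Ico (0 : ℝ) 1 := ⟨hs.1.le, hs.2⟩
  have hs0 := hs.1
  have hs1 : 0 < 1 - s := sub_pos.mpr hs.2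
  have hvs := hV.pos s hs'
  have hbound : ∀ z : unitDisc, ‖(z : ℂ) ^ n‖ ≤ s ^ n / v s * V.toFun z := fun z => by
    have hz := norm_mem_Ico_of_mem_unitDisc z
    rw [norm_pow, hV z]
    exact (div_le_iff₀ (hV.pos _ hz)).mp (hmax hz)
  let f : WeightedSpace V := WeightedSpace.ofBound (fun z : unitDisc => (z : ℂ) ^ n)
    (isHolomorphic_restrict (differentiable_pow n).differentiableOn) _ hbound
  have hf : ‖f‖ ≤ s ^ n / v s := WeightedSpace.norm_le_of_forall_le (by positivity) hbound
  have hderiv : ‖complexDeriv f.fn ⟨s, ofReal_mem_unitDisc hs'⟩‖ = n * s ^ (n - 1) := by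
    refine (congrArg norm (complexDeriv_restrict_apply (fun z => z ^ n) _)).trans ?_
    simp [abs_of_pos hs0]
  have hle : n * s ^ (n - 1) ≤ C * s ^ n / (1 - s) :=
    calc n * s ^ (n - 1) ≤ C * ‖f‖ * (v s / (1 - s)) := by
          rw [← hderiv, ← hW.apply_ofReal hs']
          exact hC f _
      _ ≤ C * (s ^ n / v s) * (v s / (1 - s)) := by gcongr
      _ = C * s ^ n / (1 - s) := by field_simp
  rcases eq_or_ne n 0 with rfl | hn0
  · simpa using mul_nonneg hC0 hs0.le
  refine le_of_mul_le_mul_right ?_ (pow_pos hs0 (n - 1))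
  rw [le_div_iff₀ hs1, ← mul_pow_sub_one hn0 s] at hle
  linarith

theorem exists_eventually_mul_logSlope_le (hV : V.HasProfile v)
    (hW : W.HasProfile fun r => v r / (1 - r)) (hmono : MonotoneOn v (Ico 0 1))
    (hlc : IsLogConvexDisc v) {C : ℝ} (hC0 : 0 ≤ C)
    (hC : ∀ (f : WeightedSpace V) (z : unitDisc),
      ‖complexDeriv f.fn z‖ ≤ C * ‖f‖ * W.toFun z) :
    ∃ M : ℝ, ∀ᶠ r in 𝓝[<] 1, (1 - r) * logSlope v r ≤ M := by
  refine ⟨C + 1, ?_⟩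
  filter_upwards [Ioo_mem_nhdsLT (zero_lt_one' ℝ)] with r hr
  have hr1 : 0 < 1 - r := sub_pos.mpr hr.2
  have hfloor : (⌊logSlope v r⌋₊ : ℝ) * (1 - r) ≤ C := by
    rcases eq_or_ne ⌊logSlope v r⌋₊ 0 with h0 | h0
    · simpa [h0] using hC0
    have hn := Nat.floor_le (logSlope_nonneg hV.pos hmono ⟨hr.1.le, hr.2⟩)
    obtain ⟨s, hs, hmax⟩ := hlc.exists_isMaxOn_pow_div hV.pos hV.continuousOn h0 hn hr
    have hs1 : s < 1 := hs.2.trans_lt hr.2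
    calc (⌊logSlope v r⌋₊ : ℝ) * (1 - r) ≤ ⌊logSlope v r⌋₊ * (1 - s) := by
          gcongr
          exact hs.2
      _ ≤ C * s := hV.natCast_mul_one_sub_le_of_isMaxOn hW hC0 hC ⟨hs.1, hs1⟩ hmax
      _ ≤ C := mul_le_of_le_one_right hC0 hs1.le
  have hlt := mul_le_mul_of_nonneg_left (Nat.lt_floor_add_one (logSlope v r)).le hr1.le
  linarith [hr.1]

theorem exists_complexDeriv_clm_iff (hV : V.HasProfile v)
    (hW : W.HasProfile fun r => v r / (1 - r)) (hmono : MonotoneOn v (Ico 0 1))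
    (hlc : IsLogConvexDisc v) :
    (∃ D : WeightedSpace V →L[ℂ] WeightedSpace W, ∀ f, (D f).fn = complexDeriv f.fn) ↔
      limsup (growthQuotient v) (𝓝[<] 1) < ⊤ := by
  rw [WeightedSpace.exists_complexDeriv_clm_iff, limsup_growthQuotient_lt_top_iff]
  constructor
  · rintro ⟨C, hC0, hC⟩
    exact hV.exists_eventually_mul_logSlope_le hW hmono hlc hC0 hC
  · intro h
    obtain ⟨C, hC0, hC⟩ :=
      hlc.exists_forall_map_add_one_div_two_le hV.pos hV.continuousOn hmono h
    exact ⟨2 * C, by positivity, hV.norm_complexDeriv_le hW hmono hC⟩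

theorem exists_forall_norm_le_add_mul (hV : V.HasProfile v)
    (hW : W.HasProfile fun r => v r / (1 - r)) (hmono : MonotoneOn v (Ico 0 1))
    (hlc : IsLogConvexDisc v) {c : ℝ} (hc0 : 0 < c)
    (hc : ∀ᶠ r in 𝓝[<] 1, c ≤ (1 - r) * logSlope v r) {F F' : ℂ → ℂ}
    (hF : ∀ z ∈ Metric.ball 0 1, HasDerivAt F (F' z) z) {K : ℝ} (hK0 : 0 ≤ K)
    (hK : ∀ z : unitDisc, ‖F' z‖ ≤ K * W.toFun z) :
    ∃ A, 0 ≤ A ∧ ∀ z : unitDisc, ‖F z‖ ≤ A + K / c * V.toFun z := by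
  obtain ⟨a, ha, hc⟩ := exists_forall_Ico_of_eventually_nhdsLT one_pos hc
  have hcont : ContinuousOn F (Metric.closedBall 0 a) := fun z hz =>
    (hF z (Metric.closedBall_subset_ball ha.2 hz)).continuousAt.continuousWithinAt
  obtain ⟨A, hA⟩ := (isCompact_closedBall (0 : ℂ) a).exists_bound_of_continuousOn hcont
  have hA0 : 0 ≤ A := (norm_nonneg _).trans (hA 0 (Metric.mem_closedBall_self ha.1.le))
  have hsub : Ico a 1 ⊆ Ioo 0 1 := Ico_subset_Ioo_left ha.1
  refine ⟨A, hA0, fun z => ?_⟩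
  have hz := norm_mem_Ico_of_mem_unitDisc z
  have hKv : ∀ r ∈ Ico (0 : ℝ) 1, 0 ≤ K / c * v r := fun r hr =>
    mul_nonneg (div_nonneg hK0 hc0.le) (hV.pos r hr).le
  rw [hV]
  rcases lt_or_ge ‖(z : ℂ)‖ a with hza | haz
  · exact (hA z (mem_closedBall_zero_iff.mpr hza.le)).trans (le_add_of_nonneg_right (hKv _ hz))
  refine norm_le_of_norm_fderiv_le_deriv_right_norm (B := fun t => A + K / c * v t)
    (B' := fun t => K / c * rightDeriv v t) ha.1.le
    (fun ζ hζ => (hF ζ hζ).hasFDerivAt.restrictScalars ℝ) (fun ζ hζ => ?_)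
    (continuousOn_const.add (continuousOn_const.mul
      (hV.continuousOn.mono (Ico_subset_Ico_left ha.1.le))))
    (fun t ht => ((hlc.hasDerivWithinAt_rightDeriv hV.pos (hsub ht)).const_mul _).const_add A)
    (fun ζ hζ => ?_) ⟨haz, hz.2⟩
  · exact (hA ζ (mem_closedBall_zero_iff.mpr hζ.le)).trans
      (le_add_of_nonneg_right (hKv a ⟨ha.1.le, ha.2⟩))
  · have hζD := hK ⟨ζ, mem_ball_zero_iff.mpr hζ.2⟩
    rw [hW] at hζD
    have hw := mul_le_mul_of_nonneg_left (div_one_sub_le_rightDeriv_div hV.pos hmono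
      ⟨norm_nonneg ζ, hζ.2⟩ hc0 (hc _ hζ)) hK0
    rw [ContinuousLinearMap.norm_restrictScalars, ContinuousLinearMap.norm_toSpanSingleton]
    calc ‖F' ζ‖ ≤ K * (rightDeriv v ‖ζ‖ / c) := hζD.trans hw
      _ = K / c * rightDeriv v ‖ζ‖ := by ring

theorem exists_complexDeriv_eq (hV : V.HasProfile v)
    (hW : W.HasProfile fun r => v r / (1 - r)) (hmono : MonotoneOn v (Ico 0 1))
    (hlc : IsLogConvexDisc v)
    (h : ∃ c > (0 : ℝ), ∀ᶠ r in 𝓝[<] 1, c ≤ (1 - r) * logSlope v r) (g : WeightedSpace W) :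
    ∃ f : WeightedSpace V, complexDeriv f.fn = g.fn := by
  obtain ⟨c, hc0, hc⟩ := h
  obtain ⟨F, hF⟩ : Complex.IsExactOn (zeroExtend g.fn) (Metric.ball 0 1) :=
    DifferentiableOn.isExactOn_ball g.isHolomorphic
  obtain ⟨A, hA0, hA⟩ := hV.exists_forall_norm_le_add_mul hW hmono hlc hc0 hc hF (norm_nonneg g)
    fun z => by simpa only [zeroExtend_apply] using g.norm_fn_le z
  have h0 : (0 : ℝ) ∈ Ico (0 : ℝ) 1 := ⟨le_rfl, one_pos⟩
  have hbound : ∀ z : unitDisc, ‖F z‖ ≤ (A / v 0 + ‖g‖ / c) * V.toFun z := fun z => by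
    have hv0 : v 0 ≤ V.toFun z := (hmono h0 (norm_mem_Ico_of_mem_unitDisc z)
      (norm_nonneg _)).trans_eq (hV z).symm
    have hA_le : A ≤ A / v 0 * V.toFun z := by
      rw [div_mul_eq_mul_div, le_div_iff₀ (hV.pos 0 h0)]
      exact mul_le_mul_of_nonneg_left hv0 hA0
    linarith [hA z]
  have hFdiff : DifferentiableOn ℂ F unitDisc := fun z hz =>
    (hF z hz).differentiableAt.differentiableWithinAt
  refine ⟨WeightedSpace.ofBound _ (isHolomorphic_restrict hFdiff) _ hbound, funext fun z => ?_⟩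
  calc complexDeriv (fun z : unitDisc => F z) z = deriv F z := complexDeriv_restrict_apply F z
    _ = g.fn z := by rw [(hF z z.2).deriv, zeroExtend_apply]

theorem norm_sub_apply_zero_le (hV : V.HasProfile v) (hmono : MonotoneOn v (Ico 0 1)) {C : ℝ}
    (hC0 : 0 ≤ C)
    (hC : ∀ g : WeightedSpace W, ∃ f : WeightedSpace V,
      complexDeriv f.fn = g.fn ∧ ‖f‖ ≤ C * ‖g‖)
    {F F' : ℂ → ℂ} (hF : ∀ z ∈ unitDisc, HasDerivAt F (F' z) z)
    (hF' : DifferentiableOn ℂ F' unitDisc) {K : ℝ} (hK0 : 0 ≤ K)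
    (hK : ∀ z : unitDisc, ‖F' z‖ ≤ K * W.toFun z) (z : unitDisc) :
    ‖F z - F 0‖ ≤ 2 * (C * K) * V.toFun z := by
  obtain ⟨f, hfF', hf⟩ := hC (WeightedSpace.ofBound _ (isHolomorphic_restrict hF') K hK)
  have hfK : ‖f‖ ≤ C * K :=
    hf.trans (mul_le_mul_of_nonneg_left (WeightedSpace.norm_le_of_forall_le hK0 hK) hC0)
  have hderiv : EqOn (deriv F) (deriv (zeroExtend f.fn)) (unitDisc : Set ℂ) := fun ζ hζ =>
    (hF ζ hζ).deriv.trans (congrFun hfF' ⟨ζ, hζ⟩).symm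
  obtain ⟨b, hb⟩ := unitDisc.isOpen.exists_eq_add_of_deriv_eq
    (Metric.isPreconnected_ball (x := (0 : ℂ)) (r := 1))
    (fun ζ hζ => (hF ζ hζ).differentiableAt.differentiableWithinAt) f.isHolomorphic hderiv
  let o : unitDisc := ⟨0, Metric.mem_ball_self one_pos⟩
  have hdiff : F z - F 0 = f.fn z - f.fn o := by
    have hz : F z = f.fn z + b := (hb z.2).trans (congrArg (· + b) (zeroExtend_apply f.fn z))
    have ho : F 0 = f.fn o + b := (hb o.2).trans (congrArg (· + b) (zeroExtend_apply f.fn o))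
    rw [hz, ho, add_sub_add_right_eq_sub]
  have hVo : V.toFun o ≤ V.toFun z := by
    rw [hV, hV]
    exact hmono (norm_mem_Ico_of_mem_unitDisc o) (norm_mem_Ico_of_mem_unitDisc z)
      (norm_zero.trans_le (norm_nonneg _))
  calc ‖F z - F 0‖ ≤ ‖f.fn z‖ + ‖f.fn o‖ := hdiff ▸ norm_sub_le _ _
    _ ≤ ‖f‖ * V.toFun z + ‖f‖ * V.toFun z := add_le_add (f.norm_fn_le z)
        ((f.norm_fn_le o).trans (mul_le_mul_of_nonneg_left hVo (norm_nonneg f)))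
    _ = 2 * ‖f‖ * V.toFun z := by ring
    _ ≤ 2 * (C * K) * V.toFun z :=
        mul_le_mul_of_nonneg_right (mul_le_mul_of_nonneg_left hfK two_pos.le) (V.pos z).le

theorem exp_neg_le_natCast_mul_one_sub (hV : V.HasProfile v)
    (hW : W.HasProfile fun r => v r / (1 - r)) (hmono : MonotoneOn v (Ico 0 1))
    (hlc : IsLogConvexDisc v) {C : ℝ} (hC0 : 0 ≤ C)
    (hC : ∀ g : WeightedSpace W, ∃ f : WeightedSpace V,
      complexDeriv f.fn = g.fn ∧ ‖f‖ ≤ C * ‖g‖)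
    {r : ℝ} (hr : r ∈ Ioo (0 : ℝ) 1) {n : ℕ} (hn0 : n ≠ 0) (hn : logSlope v r ≤ n) :
    Real.exp (-(2 * C + 1)) ≤ n * (1 - r) := by
  have hr' : r ∈ Ico (0 : ℝ) 1 := ⟨hr.1.le, hr.2⟩
  have hr1 : 0 < 1 - r := sub_pos.mpr hr.2
  have hvr := hV.pos r hr'
  have hbound : ∀ z : unitDisc, ‖(v r : ℂ) * ((z : ℂ) ^ n * (1 - (z : ℂ))⁻¹)‖ ≤
      1 * W.toFun z := fun z => by
    have hz := norm_mem_Ico_of_mem_unitDisc z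
    have hz1 : 1 - ‖(z : ℂ)‖ ≤ ‖1 - (z : ℂ)‖ := by
      simpa using norm_sub_norm_le 1 (z : ℂ)
    rw [norm_mul, norm_mul, norm_inv, norm_pow, Complex.norm_of_nonneg hvr.le, one_mul, hW,
      ← mul_assoc, ← div_eq_mul_inv]
    exact div_le_div₀ (hV.pos _ hz).le (hlc.mul_pow_le hV.pos hmono hn0 hn hr hz)
      (sub_pos.mpr hz.2) hz1
  have hne : ∀ z ∈ unitDisc, 1 - z ≠ 0 := fun z hz =>
    Complex.slitPlane_ne_zero (one_sub_mem_slitPlane hz)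
  have hdiff : DifferentiableOn ℂ (fun z : ℂ => (v r : ℂ) * (z ^ n * (1 - z)⁻¹)) unitDisc :=
    ((differentiableOn_pow n).mul ((differentiableOn_id.const_sub 1).inv hne)).const_mul _
  have hnorm := hV.norm_sub_apply_zero_le hmono hC0 hC
    (fun z hz => (hasDerivAt_negLogTail n hz).const_mul (v r : ℂ)) hdiff zero_le_one hbound
    ⟨r, ofReal_mem_unitDisc hr'⟩
  rw [← mul_sub, negLogTail_zero, sub_zero, norm_mul, Complex.norm_of_nonneg hvr.le,
    hV.apply_ofReal hr', mul_one, mul_comm] at hnorm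
  have htail := (neg_log_mul_one_sub_sub_one_le_norm_negLogTail hn0 hr').trans
    (le_of_mul_le_mul_right hnorm hvr)
  rw [← Real.le_log_iff_exp_le (by positivity)]
  linarith

theorem exists_pos_eventually_le_mul_logSlope (hV : V.HasProfile v)
    (hW : W.HasProfile fun r => v r / (1 - r)) (hmono : MonotoneOn v (Ico 0 1))
    (hlc : IsLogConvexDisc v) {C : ℝ} (hC0 : 0 ≤ C)
    (hC : ∀ g : WeightedSpace W, ∃ f : WeightedSpace V,
      complexDeriv f.fn = g.fn ∧ ‖f‖ ≤ C * ‖g‖) :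
    ∃ c > (0 : ℝ), ∀ᶠ r in 𝓝[<] 1, c ≤ (1 - r) * logSlope v r := by
  set c := Real.exp (-(2 * C + 1)) / 2 with hc
  have hc0 : 0 < c := by positivity
  refine ⟨c, hc0, ?_⟩
  filter_upwards [Ioo_mem_nhdsLT (zero_lt_one' ℝ), Ioo_mem_nhdsLT (sub_lt_self 1 hc0)]
    with r hr hrc
  have hr1 : 0 < 1 - r := sub_pos.mpr hr.2
  have hfloor := Nat.floor_le (logSlope_nonneg hV.pos hmono ⟨hr.1.le, hr.2⟩)
  have hexp := hV.exp_neg_le_natCast_mul_one_sub hW hmono hlc hC0 hC hr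
    (Nat.succ_ne_zero ⌊logSlope v r⌋₊) (by exact_mod_cast (Nat.lt_floor_add_one _).le)
  push_cast at hexp
  have hle := mul_le_mul_of_nonneg_right hfloor hr1.le
  linarith [hrc.1]

theorem surjective_iff (hV : V.HasProfile v) (hW : W.HasProfile fun r => v r / (1 - r))
    (hmono : MonotoneOn v (Ico 0 1)) (hlc : IsLogConvexDisc v)
    {D : WeightedSpace V →L[ℂ] WeightedSpace W} (hD : ∀ f, (D f).fn = complexDeriv f.fn) :
    Function.Surjective D ↔ 0 < liminf (growthQuotient v) (𝓝[<] 1) := by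
  rw [liminf_growthQuotient_pos_iff]
  constructor
  · intro hsurj
    obtain ⟨C, hC0, hC⟩ := D.exists_preimage_norm_le hsurj
    refine hV.exists_pos_eventually_le_mul_logSlope hW hmono hlc hC0.le fun g => ?_
    obtain ⟨f, rfl, hf⟩ := hC g
    exact ⟨f, (hD f).symm, hf⟩
  · intro h g
    obtain ⟨f, hf⟩ := hV.exists_complexDeriv_eq hW hmono hlc h g
    exact ⟨f, WeightedSpace.fn_injective ((hD f).trans hf)⟩

end Weight.HasProfile

theorem mainTheorem5_general {v : ℝ → ℝ} {V W : Weight unitDisc} (hV : V.HasProfile v)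
    (hW : W.HasProfile fun r => v r / (1 - r)) (hmono : MonotoneOn v (Ico 0 1))
    (hlc : IsLogConvexDisc v) :
    DiffIsEpimorphism V W ↔
      0 < liminf (growthQuotient v) (𝓝[<] 1) ∧
        liminf (growthQuotient v) (𝓝[<] 1) ≤ limsup (growthQuotient v) (𝓝[<] 1) ∧
        limsup (growthQuotient v) (𝓝[<] 1) < ⊤ := by
  constructor
  · rintro ⟨D, hD, hsurj⟩
    exact ⟨(hV.surjective_iff hW hmono hlc hD).mp hsurj, liminf_le_limsup,
      (hV.exists_complexDeriv_clm_iff hW hmono hlc).mp ⟨D, hD⟩⟩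
  · rintro ⟨hinf, -, hsup⟩
    obtain ⟨D, hD⟩ := (hV.exists_complexDeriv_clm_iff hW hmono hlc).mpr hsup
    exact ⟨D, hD, (hV.surjective_iff hW hmono hlc hD).mpr hinf⟩

theorem mainTheorem5 (v : ℝ → ℝ) (hv : IsRadialDiscWeight v) (hlc : IsLogConvexDisc v) :
    DiffIsEpimorphism hv.toWeight hv.div_one_sub.toWeight ↔
      0 < liminf (growthQuotient v) (𝓝[<] 1) ∧
        liminf (growthQuotient v) (𝓝[<] 1) ≤ limsup (growthQuotient v) (𝓝[<] 1) ∧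
        limsup (growthQuotient v) (𝓝[<] 1) < ⊤ :=
  mainTheorem5_general (fun _ => rfl) (fun _ => rfl) hv.monotoneOn hlc
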